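/- Simple types over a single ground type $\mathrm{bool}$ are generated from $\mathrm{bool}$ by $\sigma,\tau\mapsto\sigma\to\tau$. A type frame $\mathcal M$ is a family of sets $\mathcal M_\sigma$ indexed by simple types, such that $\mathcal M_{\sigma\to\tau}$ is a set of functions from $\mathcal M_\sigma$ to $\mathcal M_\tau$. An $\mathcal M$-environment $\rho$ assigns to each typed variable $x:\delta$ (there are countably many at each type) an element of $\mathcal M_\delta$. The terms $P$ of the simply typed $\lambda$-calculus without constants are interpreted as usual: $[\![x]\!]_\rho=\rho(x)$, $[\![PQ]\!]_\rho=[\![P]\!]_\rho([\![Q]\!]_\rho)$, and $[\![\lambda z.P]\!]_\rho$ is the function $d\mapsto[\![P]\!]_{\rho[z:=d]}$, which is required to belong to the frame. A pre-logical relation between type frames $\mathcal M$ and $\mathcal N$, in both of which all terms have interpretations, is a family of relations $R_\sigma\subseteq\mathcal M_\sigma\times\mathcal N_\sigma$ such that 1. if $(f,g)\in R_{\sigma\to\tau}$ and $(x,y)\in R_\sigma$, then $(f(x),g(y))\in R_\tau$; 2. for every term $P$ of type $\tau$, every variable $z:\sigma$, and all environments $\rho,\rho'$ of $\mathcal M,\mathcal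 N$ with $(\rho(x),\rho'(x))\in R_\delta$ for all variables $x:\delta$: if $([\![P]\!]^{\mathcal M}_{\rho[z:=a]},[\![P]\!]^{\mathcal N}_{\rho'[z:=b]})\in R_\tau$ for all $(a,b)\in R_\sigma$, then $([\![\lambda z.P]\!]^{\mathcal M}_{\rho},[\![\lambda z.P]\!]^{\mathcal N}_{\rho'})\in R_{\sigma\to\tau}$. An extensional collapse situation $\mathcal M\to^{E}\mathcal N$ consists of type frames $\mathcal M,\mathcal N$ and a pre-logical relation $E$ between them such that, at every type $\sigma$, $E_\sigma$ is a partial function from $\mathcal M_\sigma$ to $\mathcal N_\sigma$ that is surjective onto $\mathcal N_\sigma$. Let $\mathcal S$ be the full type hierarchy over $\mathcal S_{\mathrm{bool}}=\{t,f\}$, i.e. $\mathcal S_{\sigma\to\tau}$ is the set of all functions from $\mathcal S_\sigma$ to $\mathcal S_\tau$. Let $\mathcal C,\mathcal E,\mathcal L$ be the hierarchies of monotone functions, ordered pointwise, over the partial orders $\mathcal C_{\mathrm{bool}}=\{\bot,t,f\}$ with $\bot<t,f$; $\mathcal E_{\mathrm{bool}}=\{t,f,\top\}$ with $t,f<\top$;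 and $\mathcal L_{\mathrm{bool}}=\{\bot,t,f,\top\}$ with $\bot<t,f<\top$. **Proposition.** There are extensional collapse situations $$\mathcal C\to^{E_1}\mathcal S,\quad \mathcal E\to^{E_2}\mathcal S,\quad \mathcal C\to^{E_3}\mathcal E,\quad \mathcal E\to^{E_4}\mathcal C,\quad \mathcal L\to^{E_5}\mathcal C,\quad \mathcal L\to^{E_6}\mathcal E$$ which at type $\mathrm{bool}$ are the canonical surjections: $E_1,E_2,E_5,E_6$ are there the partial identities (defined exactly on the elements common to source and target), $(E_3)_{\mathrm{bool}}=\{(t,t),(f,f),(\bot,\top)\}$ and $(E_4)_{\mathrm{bool}}=\{(t,t),(f,f),(\top,\bot)\}$. Moreover the typewise composites are extensional collapse situations: $E_3\circ E_5$ from $\mathcal L$ to $\mathcal E$ (with $\bot\mapsto\top$ at $\mathrm{bool}$), and $E_1\circ E_5$ and $E_2\circ E_6$ from $\mathcal L$ to $\mathcal S$. -/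

import Mathlib

namespace Collapse

/-- Simple types over a set `K` of ground types. -/
inductive Ty (K : Type) : Type
  | ground : K → Ty K
  | arrow : Ty K → Ty K → Ty K

/-- Typed variables: countably many at each simple type. -/
structure Var (K : Type) : Type where
  ty : Ty K
  idx : ℕ

/-- Terms of the simply typed `λ`-calculus over `K`, without constants. -/
inductive Term (K : Type) : Ty K → Type
  | var (x : Var K) : Term K x.ty
  | app {σ τ : Ty K} (P : Term K (Ty.arrow σ τ)) (Q : Term K σ) : Term K τ
  | lam {τ : Ty K} (z : Var K) (P : Term K τ) : Term K (Ty.arrow z.ty τ)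

/-- Type frames over `K`. The set at `σ → τ` is a set of functions from the set at `σ` to the set
at `τ`: its elements are applied by `app`, and are determined by their values. -/
structure TypeFrame (K : Type) where
  carrier : Ty K → Type
  app : ∀ {σ τ : Ty K}, carrier (Ty.arrow σ τ) → carrier σ → carrier τ
  ext : ∀ {σ τ : Ty K} (f g : carrier (Ty.arrow σ τ)), (∀ x, app f x = app g x) → f = g

/-- Environments: a type-respecting assignment of elements of the frame to all variables. -/
abbrev Env {K : Type} (M : TypeFrame K) : Type := ∀ x : Var K, M.carrier x.ty

open Classical in
/-- `Interp M P ρ d` says that the interpretation of the term `P` in the frame `M`, in the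
environment `ρ`, is defined and equal to `d`. The interpretation of `λ z. P` is the element of the
frame which is the function `d ↦ ⟦P⟧ (ρ[z := d])`, if there is such an element. -/
def Interp {K : Type} (M : TypeFrame K) : {τ : Ty K} → Term K τ → Env M → M.carrier τ → Prop
  | _, Term.var x, ρ, d => d = ρ x
  | _, Term.app P Q, ρ, d => ∃ f a, Interp M P ρ f ∧ Interp M Q ρ a ∧ d = M.app f a
  | _, Term.lam z P, ρ, f => ∀ d, Interp M P (Function.update ρ z d) (M.app f d)

/-- Interpretations are unique. -/
theorem Interp.unique {K : Type} {M : TypeFrame K} {τ : Ty K} {P : Term K τ} {ρ : Env M}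
    {d d' : M.carrier τ} (h : Interp M P ρ d) (h' : Interp M P ρ d') : d = d' := by
  induction P generalizing ρ with
  | var x =>
    simp only [Interp] at h h'
    rw [h, h']
  | app P Q ihP ihQ =>
    simp only [Interp] at h h'
    obtain ⟨f, a, hf, ha, rfl⟩ := h
    obtain ⟨f', a', hf', ha', rfl⟩ := h'
    rw [ihP hf hf', ihQ ha ha']
  | lam z P ih =>
    simp only [Interp] at h h'
    exact M.ext _ _ fun x => ih (h x) (h' x)

/-- A type frame is a model of the simply typed `λ`-calculus if all terms have an interpretation
in it. -/
def IsModel {K : Type} (M : TypeFrame K) : Prop :=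
  ∀ (τ : Ty K) (P : Term K τ) (ρ : Env M), ∃ d, Interp M P ρ d

/-- Families of binary relations between two type frames, indexed by simple types. -/
abbrev FrameRel {K : Type} (M N : TypeFrame K) : Type :=
  ∀ σ : Ty K, M.carrier σ → N.carrier σ → Prop

/-- Typewise composition: first `R`, then `R'`. -/
def FrameRel.comp {K : Type} {M N P : TypeFrame K} (R : FrameRel M N) (R' : FrameRel N P) :
    FrameRel M P :=
  fun σ x z => ∃ y, R σ x y ∧ R' σ y z

open Classical in
/-- Binary pre-logical relations between `M` and `N`. The clause `lam` speaks about the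
interpretations of terms; the first two clauses record that these interpretations exist. -/
structure IsPreLogical {K : Type} (M N : TypeFrame K) (R : FrameRel M N) : Prop where
  model_left : IsModel M
  model_right : IsModel N
  app : ∀ (σ τ : Ty K) (f : M.carrier (Ty.arrow σ τ)) (g : N.carrier (Ty.arrow σ τ)),
    R (Ty.arrow σ τ) f g → ∀ x y, R σ x y → R τ (M.app f x) (N.app g y)
  lam : ∀ (τ : Ty K) (P : Term K τ) (ρ : Env M) (ρ' : Env N) (z : Var K),
    (∀ x : Var K, R x.ty (ρ x) (ρ' x)) →
    (∀ a b, R z.ty a b → ∀ c d, Interp M P (Function.update ρ z a) c →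
      Interp N P (Function.update ρ' z b) d → R τ c d) →
    ∀ f g, Interp M (Term.lam z P) ρ f → Interp N (Term.lam z P) ρ' g →
      R (Ty.arrow z.ty τ) f g

/-- Extensional collapse situations: `E` is a pre-logical relation from `M` to `N` which is a
partial surjective function at all types. -/
structure IsCollapse {K : Type} (M N : TypeFrame K) (E : FrameRel M N) : Prop where
  preLogical : IsPreLogical M N E
  surjective : ∀ (σ : Ty K) (y : N.carrier σ), ∃ x, E σ x y
  functional : ∀ (σ : Ty K) (x : M.carrier σ) (y y' : N.carrier σ), E σ x y → E σ x y' → y = y'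

/-- The full type hierarchy over a family of sets. -/
def fullCarrier {K : Type} (B : K → Type) : Ty K → Type
  | Ty.ground k => B k
  | Ty.arrow σ τ => fullCarrier B σ → fullCarrier B τ

def fullFrame {K : Type} (B : K → Type) : TypeFrame K where
  carrier := fullCarrier B
  app {σ τ} f x := (show fullCarrier B σ → fullCarrier B τ from f) x
  ext _ _ h := funext h

/-- The hierarchy of monotone functions, ordered pointwise, over a family of partial orders. -/
def monoCarrier {K : Type} (B : K → PartOrd.{0}) : Ty K → PartOrd.{0}
  | Ty.ground k => B k
  | Ty.arrow σ τ => PartOrd.of (monoCarrier B σ →o monoCarrier B τ)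

def monoFrame {K : Type} (B : K → PartOrd.{0}) : TypeFrame K where
  carrier σ := monoCarrier B σ
  app {σ τ} f x := (show monoCarrier B σ →o monoCarrier B τ from f) x
  ext _ _ h := OrderHom.ext _ _ (funext h)

/-- The four values `⊥`, `tt`, `ff`, `⊤`. -/
inductive Val : Type
  | bot | tt | ff | top

/-- The order `⊥ < tt, ff < ⊤`. -/
instance : PartialOrder Val where
  le v w := v = w ∨ v = Val.bot ∨ w = Val.top
  le_refl _ := Or.inl rfl
  le_trans u v w := by cases u <;> cases v <;> cases w <;> simp
  le_antisymm v w := by cases v <;> cases w <;> simp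

/-- The exchange of `⊥` and `⊤`. -/
def Val.dual : Val → Val
  | Val.bot => Val.top
  | Val.tt => Val.tt
  | Val.ff => Val.ff
  | Val.top => Val.bot

/-- `{tt, ff}`. -/
abbrev SBool : Type := {v : Val // v ≠ Val.bot ∧ v ≠ Val.top}

/-- `{⊥, tt, ff}`, with the order `⊥ < tt, ff`. -/
abbrev CBool : Type := {v : Val // v ≠ Val.top}

/-- `{tt, ff, ⊤}`, with the order `tt, ff < ⊤`. -/
abbrev EBool : Type := {v : Val // v ≠ Val.bot}

/-- `{⊥, tt, ff, ⊤}`, with the order `⊥ < tt, ff < ⊤`. -/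
abbrev LBool : Type := Val

/-- The single ground type. -/
inductive Ground : Type
  | bool

abbrev boolTy : Ty Ground := Ty.ground Ground.bool

def frameS : TypeFrame Ground := fullFrame fun _ => SBool
def frameC : TypeFrame Ground := monoFrame fun _ => PartOrd.of CBool
def frameE : TypeFrame Ground := monoFrame fun _ => PartOrd.of EBool
def frameL : TypeFrame Ground := monoFrame fun _ => PartOrd.of LBool

end Collapse

/-! Five of the relations are logical relations generated by the ground maps. Such a relation is
pre-logical as soon as both frames are models, and it is single-valued at `σ → τ` when it is
surjective at `σ` and single-valued at `τ`. Surjectivity at `σ → τ` is the real problem: a function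
on the target must be lifted to a monotone one on the source, and each kind of collapse carries its
own stronger induction hypothesis for this. Onto `S` it is upward closure, with `⊥` as value off the
domain (`isCollapse_mono_full`). Between `C` and `E` it is order-reversing bijectivity, with lifting
by conjugation (`isCollapse_mono_dual`). From `L` it is monotonicity with a monotone section, with
lifting by suprema (`isCollapse_mono_mono`). The map from `E` to `S` and the composites follow from
`IsCollapse.comp`. -/

namespace Collapse

variable {K : Type}

/-! ### Both hierarchies interpret all terms -/

section Models

theorem isModel_fullFrame (B : K → Type) : IsModel (fullFrame B) := by
  intro τ P
  induction P with
  | var x => exact fun ρ => ⟨ρ x, by simp only [Interp]⟩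
  | app P Q ihP ihQ =>
    intro ρ
    obtain ⟨f, hf⟩ := ihP ρ
    obtain ⟨a, ha⟩ := ihQ ρ
    exact ⟨(fullFrame B).app f a, by simp only [Interp]; exact ⟨f, a, hf, ha, rfl⟩⟩
  | lam z P ih =>
    intro ρ
    choose D hD using ih
    classical
    refine ⟨fun d : fullCarrier B z.ty => D (Function.update ρ z d), ?_⟩
    simp only [Interp]
    exact fun d => hD (Function.update ρ z d)

/-- In the hierarchy of monotone functions, every term has an interpretation which depends
monotonically on the environment. -/
theorem exists_monotone_interp_monoFrame (B : K → PartOrd.{0}) {τ : Ty K} (P : Term K τ) :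
    ∃ D : (∀ x : Var K, monoCarrier B x.ty) →o monoCarrier B τ,
      ∀ ρ : Env (monoFrame B), Interp (monoFrame B) P ρ (D ρ) := by
  induction P with
  | var x => exact ⟨⟨fun ρ => ρ x, fun _ _ h => h x⟩, fun ρ => by simp only [Interp]; rfl⟩
  | @app σ τ P Q ihP ihQ =>
    obtain ⟨F, hF⟩ := ihP
    obtain ⟨D, hD⟩ := ihQ
    let F' : (∀ x : Var K, monoCarrier B x.ty) →o (monoCarrier B σ →o monoCarrier B τ) := F
    refine ⟨⟨fun ρ => F' ρ (D ρ), fun ρ ρ' h => ?_⟩, fun ρ => ?_⟩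
    · exact (F'.monotone h (D ρ)).trans ((F' ρ').monotone (D.monotone h))
    · simp only [Interp]
      exact ⟨F ρ, D ρ, hF ρ, hD ρ, rfl⟩
  | @lam τ z P ih =>
    obtain ⟨D, hD⟩ := ih
    classical
    have hup : ∀ (ρ ρ' : ∀ x : Var K, monoCarrier B x.ty) (d d' : monoCarrier B z.ty),
        ρ ≤ ρ' → d ≤ d' → Function.update ρ z d ≤ Function.update ρ' z d' := by
      intro ρ ρ' d d' h hd
      exact update_le_update_iff.2 ⟨hd, fun x _ => h x⟩
    -- Monotonicity in the bound variable puts the abstraction in the frame; monotonicity in the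
    -- other variables keeps the induction going.
    let F : (∀ x : Var K, monoCarrier B x.ty) →o (monoCarrier B z.ty →o monoCarrier B τ) :=
      ⟨fun ρ => ⟨fun d => D (Function.update ρ z d),
        fun d d' h => D.monotone (hup ρ ρ d d' le_rfl h)⟩,
        fun ρ ρ' h d => D.monotone (hup ρ ρ' d d h le_rfl)⟩
    refine ⟨F, fun ρ => ?_⟩
    simp only [Interp]
    exact fun d => hD (Function.update ρ z d)

theorem isModel_monoFrame (B : K → PartOrd.{0}) : IsModel (monoFrame B) := by
  intro τ P ρ
  obtain ⟨D, hD⟩ := exists_monotone_interp_monoFrame B P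
  exact ⟨_, hD ρ⟩

end Models

/-! ### Pre-logical relations and their composition -/

section PreLogical

/-- The fundamental lemma of pre-logical relations. -/
theorem IsPreLogical.interp {M N : TypeFrame K} {R : FrameRel M N} (hR : IsPreLogical M N R)
    {τ : Ty K} (P : Term K τ) {ρ : Env M} {ρ' : Env N} (hρ : ∀ x : Var K, R x.ty (ρ x) (ρ' x))
    {c : M.carrier τ} {d : N.carrier τ} (hc : Interp M P ρ c) (hd : Interp N P ρ' d) :
    R τ c d := by
  induction P generalizing ρ ρ' with
  | var x =>
    simp only [Interp] at hc hd
    subst hc hd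
    exact hρ x
  | app P Q ihP ihQ =>
    simp only [Interp] at hc hd
    obtain ⟨f, a, hf, ha, rfl⟩ := hc
    obtain ⟨g, b, hg, hb, rfl⟩ := hd
    exact hR.app _ _ _ _ (ihP hρ hf hg) _ _ (ihQ hρ ha hb)
  | lam z P ih =>
    classical
    refine hR.lam _ P ρ ρ' z hρ (fun a b hab c d hc hd => ih (fun x => ?_) hc hd) c d hc hd
    by_cases hx : x = z
    · subst hx
      rw [Function.update_self, Function.update_self]
      exact hab
    · rw [Function.update_of_ne hx, Function.update_of_ne hx]
      exact hρ x

/-- An abstraction is linked through its own interpretation in `N`, in an environment of pointwise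
chosen intermediate values; the fundamental lemma relates it to both sides. -/
theorem IsPreLogical.comp {M N P : TypeFrame K} {R : FrameRel M N} {R' : FrameRel N P}
    (hR : IsPreLogical M N R) (hR' : IsPreLogical N P R') : IsPreLogical M P (R.comp R') where
  model_left := hR.model_left
  model_right := hR'.model_right
  app := by
    rintro σ τ f g ⟨h, hf, hg⟩ x y ⟨w, hx, hy⟩
    exact ⟨_, hR.app _ _ _ _ hf _ _ hx, hR'.app _ _ _ _ hg _ _ hy⟩
  lam := by
    intro τ Q ρ ρ' z hρ _ f g hf hg
    choose ρ'' h h' using hρ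
    obtain ⟨e, he⟩ := hR.model_right _ (Term.lam z Q) ρ''
    exact ⟨e, hR.interp _ h hf he, hR'.interp _ h' he hg⟩

theorem IsCollapse.comp {M N P : TypeFrame K} {R : FrameRel M N} {R' : FrameRel N P}
    (hR : IsCollapse M N R) (hR' : IsCollapse N P R') : IsCollapse M P (R.comp R') where
  preLogical := hR.preLogical.comp hR'.preLogical
  surjective σ z := by
    obtain ⟨y, hy⟩ := hR'.surjective σ z
    obtain ⟨x, hx⟩ := hR.surjective σ y
    exact ⟨x, y, hx, hy⟩
  functional := by
    rintro σ x z z' ⟨y, hy, hz⟩ ⟨y', hy', hz'⟩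
    obtain rfl := hR.functional σ x y y' hy hy'
    exact hR'.functional σ y z z' hz hz'

end PreLogical

/-! ### Logical relations -/

section Logical

/-- The logical relation generated by relations at the ground types. -/
def logicalRel (M N : TypeFrame K)
    (R : ∀ k, M.carrier (Ty.ground k) → N.carrier (Ty.ground k) → Prop) : FrameRel M N
  | Ty.ground k => R k
  | Ty.arrow σ τ => fun f g =>
      ∀ x y, logicalRel M N R σ x y → logicalRel M N R τ (M.app f x) (N.app g y)

variable {M N : TypeFrame K}
  {R : ∀ k, M.carrier (Ty.ground k) → N.carrier (Ty.ground k) → Prop}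

theorem isPreLogical_logicalRel (hM : IsModel M) (hN : IsModel N) :
    IsPreLogical M N (logicalRel M N R) where
  model_left := hM
  model_right := hN
  app _ _ _ _ h := h
  lam τ P ρ ρ' z _ h f g hf hg := by
    simp only [Interp] at hf hg
    exact fun x y hxy => h x y hxy _ _ (hf x) (hg y)

theorem logicalRel_functional_arrow {σ τ : Ty K}
    (hσ : ∀ y, ∃ x, logicalRel M N R σ x y)
    (hτ : ∀ x y y', logicalRel M N R τ x y → logicalRel M N R τ x y' → y = y')
    (f : M.carrier (Ty.arrow σ τ)) (g g' : N.carrier (Ty.arrow σ τ))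
    (h : logicalRel M N R (Ty.arrow σ τ) f g) (h' : logicalRel M N R (Ty.arrow σ τ) f g') :
    g = g' := by
  refine N.ext _ _ fun y => ?_
  obtain ⟨x, hx⟩ := hσ y
  exact hτ _ _ _ (h x y hx) (h' x y hx)

end Logical

/-! ### Collapse of a monotone hierarchy onto a full one -/

section MonoFull

theorem exists_isBot_monoCarrier (B : K → PartOrd.{0}) (hB : ∀ k, ∃ b : B k, IsBot b)
    (σ : Ty K) : ∃ b : monoCarrier B σ, IsBot b := by
  induction σ with
  | ground k => exact hB k
  | arrow σ τ _ ih =>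
    obtain ⟨b, hb⟩ := ih
    let c : monoCarrier B σ →o monoCarrier B τ := ⟨fun _ => b, fun _ _ _ => le_rfl⟩
    exact ⟨c, fun f x => hb ((show monoCarrier B σ →o monoCarrier B τ from f) x)⟩

/-- The hierarchy of monotone functions over pointed partial orders collapses onto the full type
hierarchy, if the relations at the ground types are upwards closed. -/
theorem isCollapse_mono_full (B : K → PartOrd.{0}) (A : K → Type) (R : ∀ k, B k → A k → Prop)
    (hbot : ∀ k, ∃ b : B k, IsBot b)
    (hsurj : ∀ k y, ∃ x, R k x y) (hfun : ∀ k x y y', R k x y → R k x y' → y = y')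
    (hup : ∀ k x x' y, x ≤ x' → R k x y → R k x' y) :
    IsCollapse (monoFrame B) (fullFrame A) (logicalRel (monoFrame B) (fullFrame A) R) := by
  set E := logicalRel (monoFrame B) (fullFrame A) R
  -- Upward closure joins the induction because it makes the lifted functions monotone.
  have key : ∀ σ, (∀ y, ∃ x, E σ x y) ∧ (∀ x y y', E σ x y → E σ x y' → y = y') ∧
      ∀ (x x' : monoCarrier B σ) y, x ≤ x' → E σ x y → E σ x' y := by
    intro σ
    induction σ with
    | ground k => exact ⟨hsurj k, hfun k, hup k⟩
    | arrow σ τ ihσ ihτ =>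
      obtain ⟨sσ, fσ, uσ⟩ := ihσ
      obtain ⟨sτ, fτ, uτ⟩ := ihτ
      refine ⟨fun g => ?_, logicalRel_functional_arrow sσ fτ, fun f f' g hle hf x y hxy => ?_⟩
      · let g' : fullCarrier A σ → fullCarrier A τ := g
        choose s hs using sτ
        obtain ⟨b, hb⟩ := exists_isBot_monoCarrier B hbot τ
        classical
        -- Constant on each fibre of `E σ`, least off the domain. Above a point of the domain one
        -- stays in its fibre, so no monotonicity of `s` is needed.
        let F : monoCarrier B σ → monoCarrier B τ := fun x =>
          if h : ∃ y, E σ x y then s (g' h.choose) else b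
        have hF : ∀ x y, E σ x y → F x = s (g' y) := by
          intro x y hxy
          have h : ∃ y, E σ x y := ⟨y, hxy⟩
          exact (dif_pos h).trans (congrArg (fun y => s (g' y)) (fσ x _ _ h.choose_spec hxy))
        have hmono : Monotone F := by
          intro x x' hle
          by_cases h : ∃ y, E σ x y
          · obtain ⟨y, hy⟩ := h
            exact ((hF x y hy).trans (hF x' y (uσ _ _ _ hle hy)).symm).le
          · have hx : F x = b := dif_neg h
            rw [hx]
            exact hb _
        refine ⟨(⟨F, hmono⟩ : monoCarrier B σ →o monoCarrier B τ), fun x y hxy => ?_⟩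
        have := hs (g' y)
        rw [← hF x y hxy] at this
        exact this
      · exact uτ _ _ _ (hle x) (hf x y hxy)
  exact ⟨isPreLogical_logicalRel (isModel_monoFrame B) (isModel_fullFrame A),
    fun σ => (key σ).1, fun σ => (key σ).2.1⟩

end MonoFull

/-! ### Order-reversing dualities -/

section MonoDual

/-- Dualities between the ground types extend to the hierarchies of monotone functions. -/
theorem isCollapse_mono_dual (B B' : K → PartOrd.{0}) (R : ∀ k, B k → B' k → Prop)
    (htot : ∀ k x, ∃ y, R k x y) (hsurj : ∀ k y, ∃ x, R k x y)
    (hanti : ∀ k x y x' y', R k x y → R k x' y' → (x ≤ x' ↔ y' ≤ y)) :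
    IsCollapse (monoFrame B) (monoFrame B') (logicalRel (monoFrame B) (monoFrame B') R) := by
  set E := logicalRel (monoFrame B) (monoFrame B') R
  have key : ∀ σ, (∀ x, ∃ y, E σ x y) ∧ (∀ y, ∃ x, E σ x y) ∧
      ∀ (x : monoCarrier B σ) (y : monoCarrier B' σ) (x' : monoCarrier B σ)
        (y' : monoCarrier B' σ), E σ x y → E σ x' y' → (x ≤ x' ↔ y' ≤ y) := by
    intro σ
    induction σ with
    | ground k => exact ⟨htot k, hsurj k, hanti k⟩
    | arrow σ τ ihσ ihτ =>
      obtain ⟨tσ, sσ, aσ⟩ := ihσ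
      obtain ⟨tτ, sτ, aτ⟩ := ihτ
      have fσ : ∀ x y y', E σ x y → E σ x y' → y = y' := fun x y y' h h' =>
        le_antisymm (α := monoCarrier B' σ) ((aσ _ _ _ _ h' h).1 (le_refl (α := monoCarrier B σ) x))
          ((aσ _ _ _ _ h h').1 (le_refl (α := monoCarrier B σ) x))
      have iσ : ∀ x x' y, E σ x y → E σ x' y → x = x' := fun x x' y h h' =>
        le_antisymm (α := monoCarrier B σ) ((aσ _ _ _ _ h h').2 (le_refl (α := monoCarrier B' σ) y))
          ((aσ _ _ _ _ h' h).2 (le_refl (α := monoCarrier B' σ) y))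
      choose φ hφ using tσ
      choose ψ hψ using sσ
      choose φ' hφ' using tτ
      choose ψ' hψ' using sτ
      refine ⟨fun f => ?_, fun g => ?_, fun f g f' g' h h' => ?_⟩
      · let f' : monoCarrier B σ →o monoCarrier B τ := f
        -- Conjugation by the dualities: two order reversals cancel.
        refine ⟨(⟨fun y => φ' (f' (ψ y)), fun y y' hle => ?_⟩ :
          monoCarrier B' σ →o monoCarrier B' τ), fun x y hxy => ?_⟩
        · exact (aτ _ _ _ _ (hφ' _) (hφ' _)).1
            (f'.monotone ((aσ _ _ _ _ (hψ y') (hψ y)).2 hle))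
        · obtain rfl := iσ _ _ _ hxy (hψ y)
          exact hφ' _
      · let g' : monoCarrier B' σ →o monoCarrier B' τ := g
        refine ⟨(⟨fun x => ψ' (g' (φ x)), fun x x' hle => ?_⟩ :
          monoCarrier B σ →o monoCarrier B τ), fun x y hxy => ?_⟩
        · exact (aτ _ _ _ _ (hψ' _) (hψ' _)).2
            (g'.monotone ((aσ _ _ _ _ (hφ x) (hφ x')).1 hle))
        · obtain rfl := fσ _ _ _ hxy (hφ x)
          exact hψ' _
      · exact ⟨fun hle y => (aτ _ _ _ _ (h _ y (hψ y)) (h' _ y (hψ y))).1 (hle (ψ y)),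
          fun hle x => (aτ _ _ _ _ (h x _ (hφ x)) (h' x _ (hφ x))).2 (hle (φ x))⟩
  refine ⟨isPreLogical_logicalRel (isModel_monoFrame B) (isModel_monoFrame B'),
    fun σ => (key σ).2.1, fun σ x y y' h h' => ?_⟩
  have a := (key σ).2.2
  exact le_antisymm (α := monoCarrier B' σ) ((a _ _ _ _ h' h).1 (le_refl (α := monoCarrier B σ) x))
    ((a _ _ _ _ h h').1 (le_refl (α := monoCarrier B σ) x))

end MonoDual

/-! ### Collapse from hierarchies with all suprema -/

section MonoMono

theorem exists_isLUB_monoCarrier (B : K → PartOrd.{0})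
    (hB : ∀ k (S : Set (B k)), ∃ a, IsLUB S a) (σ : Ty K) (S : Set (monoCarrier B σ)) :
    ∃ a, IsLUB S a := by
  induction σ with
  | ground k => exact hB k S
  | arrow σ τ _ ih =>
    let S' : Set (monoCarrier B σ →o monoCarrier B τ) := S
    choose l hl using ih
    let a : monoCarrier B σ →o monoCarrier B τ :=
      ⟨fun x => l ((fun f => f x) '' S'), fun x x' hle => (hl _).2 (by
        rintro _ ⟨f, hf, rfl⟩
        exact (f.monotone hle).trans ((hl _).1 ⟨f, hf, rfl⟩))⟩
    have ha : IsLUB S' a := by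
      refine ⟨fun f hf x => (hl _).1 ⟨f, hf, rfl⟩, fun g hg x => (hl _).2 ?_⟩
      rintro _ ⟨f, hf, rfl⟩
      exact hg hf x
    exact ⟨a, ha⟩

/-- The hierarchy of monotone functions over complete lattices collapses onto the hierarchy over
partial orders onto which the ground types are partially mapped, monotonically and with a monotone
section. -/
theorem isCollapse_mono_mono (B B' : K → PartOrd.{0}) (R : ∀ k, B k → B' k → Prop)
    (hB : ∀ k (S : Set (B k)), ∃ a, IsLUB S a)
    (hsec : ∀ k, ∃ s : B' k →o B k, ∀ y, R k (s y) y)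
    (hmono : ∀ k x y x' y', R k x y → R k x' y' → x ≤ x' → y ≤ y') :
    IsCollapse (monoFrame B) (monoFrame B') (logicalRel (monoFrame B) (monoFrame B') R) := by
  set E := logicalRel (monoFrame B) (monoFrame B') R
  have key : ∀ σ, (∃ s : monoCarrier B' σ →o monoCarrier B σ, ∀ y, E σ (s y) y) ∧
      ∀ (x : monoCarrier B σ) (y : monoCarrier B' σ) (x' : monoCarrier B σ)
        (y' : monoCarrier B' σ), E σ x y → E σ x' y' → x ≤ x' → y ≤ y' := by
    intro σ
    induction σ with
    | ground k => exact ⟨hsec k, hmono k⟩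
    | arrow σ τ ihσ ihτ =>
      obtain ⟨⟨r, hr⟩, mσ⟩ := ihσ
      obtain ⟨⟨s, hs⟩, mτ⟩ := ihτ
      refine ⟨?_, fun f g f' g' h h' hle y =>
        mτ _ _ _ _ (h _ y (hr y)) (h' _ y (hr y)) (hle (r y))⟩
      choose l hl using exists_isLUB_monoCarrier B hB τ
      -- The values that a lift of `g` through `s` takes at points of the domain below `x`; their
      -- supremum extends the lift monotonically to all of `monoCarrier B σ`.
      let T : (monoCarrier B' σ →o monoCarrier B' τ) → monoCarrier B σ →
          Set (monoCarrier B τ) := fun g x =>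
        {w | ∃ (x₀ : monoCarrier B σ) (y₀ : monoCarrier B' σ),
          x₀ ≤ x ∧ E σ x₀ y₀ ∧ w = s (g y₀)}
      let F : (monoCarrier B' σ →o monoCarrier B' τ) →o (monoCarrier B σ →o monoCarrier B τ) :=
        ⟨fun g => ⟨fun x => l (T g x), fun x x' hle => (hl _).2 (by
            rintro _ ⟨x₀, y₀, hx, h, rfl⟩
            exact (hl _).1 ⟨x₀, y₀, hx.trans hle, h, rfl⟩)⟩,
          fun g g' hle x => (hl _).2 (by
            rintro _ ⟨x₀, y₀, hx, h, rfl⟩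
            exact (s.monotone (hle y₀)).trans ((hl _).1 ⟨x₀, y₀, hx, h, rfl⟩))⟩
      have hF : ∀ g x y, E σ x y → F g x = s (g y) := by
        intro g x y hxy
        -- On the domain the supremum is attained at `x` itself, since `E σ`, `g` and `s` are all
        -- monotone.
        refine le_antisymm ((hl _).2 ?_) ((hl _).1 ⟨x, y, le_rfl, hxy, rfl⟩)
        rintro _ ⟨x₀, y₀, hx, h, rfl⟩
        exact s.monotone (g.monotone (mσ _ _ _ _ h hxy hx))
      refine ⟨F, fun g x y hxy => ?_⟩
      let g' : monoCarrier B' σ →o monoCarrier B' τ := g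
      have := hs (g' y)
      rw [← hF g' x y hxy] at this
      exact this
  refine ⟨isPreLogical_logicalRel (isModel_monoFrame B) (isModel_monoFrame B'),
    fun σ y => ?_, fun σ x y y' h h' => ?_⟩
  · obtain ⟨⟨s, hs⟩, -⟩ := key σ
    exact ⟨s y, hs y⟩
  · have m := (key σ).2
    exact le_antisymm (α := monoCarrier B' σ)
      (m _ _ _ _ h h' (le_refl (α := monoCarrier B σ) x))
      (m _ _ _ _ h' h (le_refl (α := monoCarrier B σ) x))

end MonoMono

/-! ### The ground types and the concrete collapses -/

section Ground

theorem Val.le_iff (v w : Val) : v ≤ w ↔ v = w ∨ v = Val.bot ∨ w = Val.top := Iff.rfl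

theorem Val.dual_dual (v : Val) : v.dual.dual = v := by cases v <;> rfl

theorem Val.dual_le_dual (v w : Val) : v.dual ≤ w.dual ↔ w ≤ v := by
  cases v <;> cases w <;> simp [Val.le_iff, Val.dual]

theorem Val.dual_ne_bot {v : Val} (h : v ≠ Val.top) : v.dual ≠ Val.bot := by
  cases v <;> simp_all [Val.dual]

theorem Val.dual_ne_top {v : Val} (h : v ≠ Val.bot) : v.dual ≠ Val.top := by
  cases v <;> simp_all [Val.dual]

/-- Below an element `w` other than `⊤` lie only `⊥` and `w`, so a set not contained in any `{⊥, w}`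
has `⊤` as its only upper bound. -/
theorem Val.exists_isLUB (S : Set Val) : ∃ a, IsLUB S a := by
  by_cases h : ∃ a, S ⊆ {Val.bot, a}
  · obtain ⟨a, ha⟩ := h
    by_cases haS : a ∈ S
    · refine ⟨a, fun v hv => ?_, fun w hw => hw haS⟩
      rcases ha hv with rfl | rfl
      · exact Or.inr (Or.inl rfl)
      · exact le_rfl
    · refine ⟨Val.bot, fun v hv => ?_, fun w _ => Or.inr (Or.inl rfl)⟩
      rcases ha hv with rfl | rfl
      · exact le_rfl
      · exact absurd hv haS
  · refine ⟨Val.top, fun v _ => Or.inr (Or.inr rfl), fun w hw => Or.inr (Or.inr ?_)⟩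
    by_contra hne
    refine h ⟨w, fun v hv => ?_⟩
    rcases hw hv with rfl | rfl | rfl
    · exact Or.inr rfl
    · exact Or.inl rfl
    · exact absurd rfl hne

end Ground

/-- The collapse of `C` onto `S`. -/
def collapseCS : FrameRel frameC frameS :=
  logicalRel frameC frameS fun _ (a : CBool) (b : SBool) => a.val = b.val

/-- The duality from `C` to `E`. -/
def collapseCE : FrameRel frameC frameE :=
  logicalRel frameC frameE fun _ (a : CBool) (b : EBool) => a.val.dual = b.val

/-- The duality from `E` to `C`. -/
def collapseEC : FrameRel frameE frameC :=
  logicalRel frameE frameC fun _ (a : EBool) (b : CBool) => a.val.dual = b.val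

/-- The collapse of `L` onto `C`. -/
def collapseLC : FrameRel frameL frameC :=
  logicalRel frameL frameC fun _ (a : LBool) (b : CBool) => a = b.val

/-- The collapse of `L` onto `E`. -/
def collapseLE : FrameRel frameL frameE :=
  logicalRel frameL frameE fun _ (a : LBool) (b : EBool) => a = b.val

theorem isCollapse_collapseCS : IsCollapse frameC frameS collapseCS := by
  refine isCollapse_mono_full (fun _ => PartOrd.of CBool) (fun _ => SBool)
    (fun _ (a : CBool) (b : SBool) => a.val = b.val) ?_ ?_ ?_ ?_
  · exact fun _ => ⟨(⟨Val.bot, by simp⟩ : CBool), fun _ => Or.inr (Or.inl rfl)⟩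
  · exact fun _ b => ⟨(⟨b.val, b.2.2⟩ : CBool), rfl⟩
  · exact fun _ a b b' h h' => Subtype.ext (h.symm.trans h')
  -- Upward closure holds because `tt` and `ff` are maximal in `CBool`.
  · rintro _ a a' b (h | h | h) hab
    · exact h.symm.trans hab
    · exact absurd (hab.symm.trans h) b.2.1
    · exact absurd h a'.2

theorem isCollapse_collapseCE : IsCollapse frameC frameE collapseCE := by
  refine isCollapse_mono_dual (fun _ => PartOrd.of CBool) (fun _ => PartOrd.of EBool)
    (fun _ (a : CBool) (b : EBool) => a.val.dual = b.val) ?_ ?_ ?_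
  · exact fun _ a => ⟨(⟨a.val.dual, Val.dual_ne_bot a.2⟩ : EBool), rfl⟩
  · exact fun _ b => ⟨(⟨b.val.dual, Val.dual_ne_top b.2⟩ : CBool), Val.dual_dual _⟩
  · intro _ a b a' b' h h'
    change a.val ≤ a'.val ↔ b'.val ≤ b.val
    rw [← h, ← h', Val.dual_le_dual]

theorem isCollapse_collapseEC : IsCollapse frameE frameC collapseEC := by
  refine isCollapse_mono_dual (fun _ => PartOrd.of EBool) (fun _ => PartOrd.of CBool)
    (fun _ (a : EBool) (b : CBool) => a.val.dual = b.val) ?_ ?_ ?_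
  · exact fun _ a => ⟨(⟨a.val.dual, Val.dual_ne_top a.2⟩ : CBool), rfl⟩
  · exact fun _ b => ⟨(⟨b.val.dual, Val.dual_ne_bot b.2⟩ : EBool), Val.dual_dual _⟩
  · intro _ a b a' b' h h'
    change a.val ≤ a'.val ↔ b'.val ≤ b.val
    rw [← h, ← h', Val.dual_le_dual]

theorem isCollapse_collapseLC : IsCollapse frameL frameC collapseLC := by
  refine isCollapse_mono_mono (fun _ => PartOrd.of LBool) (fun _ => PartOrd.of CBool)
    (fun _ (a : LBool) (b : CBool) => a = b.val) (fun _ => Val.exists_isLUB) ?_ ?_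
  · exact fun _ => ⟨⟨fun b : CBool => b.val, fun _ _ h => h⟩, fun _ => rfl⟩
  · rintro _ _ b _ b' rfl rfl h
    exact h

theorem isCollapse_collapseLE : IsCollapse frameL frameE collapseLE := by
  refine isCollapse_mono_mono (fun _ => PartOrd.of LBool) (fun _ => PartOrd.of EBool)
    (fun _ (a : LBool) (b : EBool) => a = b.val) (fun _ => Val.exists_isLUB) ?_ ?_
  · exact fun _ => ⟨⟨fun b : EBool => b.val, fun _ _ h => h⟩, fun _ => rfl⟩
  · rintro _ _ b _ b' rfl rfl h
    exact h

theorem collapseEC_comp_collapseCS_ground (a : EBool) (b : SBool) :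
    collapseEC.comp collapseCS boolTy a b ↔ a.val = b.val := by
  have hb : b.val.dual = b.val := by
    obtain ⟨v, h₁, h₂⟩ := b
    cases v
    · exact absurd rfl h₁
    · rfl
    · rfl
    · exact absurd rfl h₂
  constructor
  · rintro ⟨c, hac, hcb⟩
    have hac' : a.val.dual = c.val := hac
    have hcb' : c.val = b.val := hcb
    rw [← Val.dual_dual a.val, hac', hcb', hb]
  · intro h
    refine ⟨(⟨a.val.dual, Val.dual_ne_top a.2⟩ : CBool), rfl, ?_⟩
    change a.val.dual = b.val
    rw [h, hb]

end Collapse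

open Collapse in
theorem mainTheorem1 :
    ∃ (CS : FrameRel frameC frameS) (ES : FrameRel frameE frameS)
      (CE : FrameRel frameC frameE) (EC : FrameRel frameE frameC)
      (LC : FrameRel frameL frameC) (LE : FrameRel frameL frameE),
      -- the six extensional collapse situations, with the canonical surjections at ground type
      (IsCollapse frameC frameS CS ∧
        ∀ (a : CBool) (b : SBool), CS boolTy a b ↔ a.val = b.val) ∧
      (IsCollapse frameE frameS ES ∧
        ∀ (a : EBool) (b : SBool), ES boolTy a b ↔ a.val = b.val) ∧
      (IsCollapse frameC frameE CE ∧
        ∀ (a : CBool) (b : EBool), CE boolTy a b ↔ a.val.dual = b.val) ∧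
      (IsCollapse frameE frameC EC ∧
        ∀ (a : EBool) (b : CBool), EC boolTy a b ↔ a.val.dual = b.val) ∧
      (IsCollapse frameL frameC LC ∧
        ∀ (a : LBool) (b : CBool), LC boolTy a b ↔ a = b.val) ∧
      (IsCollapse frameL frameE LE ∧
        ∀ (a : LBool) (b : EBool), LE boolTy a b ↔ a = b.val) ∧
      -- composites
      IsCollapse frameL frameE (LC.comp CE) ∧
      IsCollapse frameL frameS (LC.comp CS) ∧
      IsCollapse frameL frameS (LE.comp ES) :=
  -- `EBool` has no least element, so `isCollapse_mono_full` does not apply to it; the collapse onto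
  -- `S` goes through the duality with `C`, which fixes `tt` and `ff`.
  ⟨collapseCS, collapseEC.comp collapseCS, collapseCE, collapseEC, collapseLC, collapseLE,
    ⟨isCollapse_collapseCS, fun _ _ => Iff.rfl⟩,
    ⟨isCollapse_collapseEC.comp isCollapse_collapseCS, collapseEC_comp_collapseCS_ground⟩,
    ⟨isCollapse_collapseCE, fun _ _ => Iff.rfl⟩,
    ⟨isCollapse_collapseEC, fun _ _ => Iff.rfl⟩,
    ⟨isCollapse_collapseLC, fun _ _ => Iff.rfl⟩,
    ⟨isCollapse_collapseLE, fun _ _ => Iff.rfl⟩,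
    isCollapse_collapseLC.comp isCollapse_collapseCE,
    isCollapse_collapseLC.comp isCollapse_collapseCS,
    isCollapse_collapseLE.comp (isCollapse_collapseEC.comp isCollapse_collapseCS)⟩
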